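/- Fix integers $K \ge 2$ and $B \ge 0$, a real $\alpha \in (0,1]$, and group proportions $\lambda_1,\dots,\lambda_K > 0$ with $\sum_{k=1}^K \lambda_k = 1$. In the $K$-group secretary problem, $N$ candidates from a strictly totally ordered set of size $N$ arrive in a uniformly random order $x_1,\dots,x_N$. The group $g_t \in \{1,\dots,K\}$ of $x_t$ satisfies $\mathbf P(g_t = k) = \lambda_k$, and $g_1,\dots,g_N$ are mutually independent and independent of the arrival order. The single-threshold algorithm $\mathcal A^B_T$ with threshold $T$ and comparison budget $B$ works as follows. All candidates arriving at steps $t < T$ are rejected. At each step $t \ge T$, if $x_t$ is not the best among the candidates $x_1,\dots,x_t$ of its own group, it is rejected. If $x_t$ is the best of its own group so far and the remaining budget is $0$, then $x_t$ is selected and the algorithm stops. If $x_t$ is the best of its own group so far and the remaining budget is positive, the algorithm spends one unit of budget to learn whether $x_t$ is the best among all of $x_1,\dots,x_t$; if so, $x_t$ is selected and the algorithm stops, and otherwise $x_t$ is rejected. Rejections and selections are irrevocable. The algorithm succeeds if it selects the best of all $N$ candidates. Then $$\lim_{N\to\infty} \mathbf P\big(\mathcal A^B_{\lfloor \alpha N\rfloor}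 \text{ succeeds}\big) = \frac{\alpha^K}{K-1}\sum_{b=0}^{B}\left(\frac{1}{\alpha^{K-1}} - \sum_{\ell=0}^{b}\frac{\log(1/\alpha^{K-1})^{\ell}}{\ell!}\right).$$ In particular, the limit does not depend on the group proportions $\lambda_k$. -/

import Mathlib

open Filter Topology MeasureTheory ProbabilityTheory
open scoped Nat ENNReal

namespace Secretary

/-- Every event about the (finite) set of arrival orders is measurable. -/
instance permMeasurableSpace (N : ℕ) : MeasurableSpace (Equiv.Perm (Fin N)) := ⊤

/-- An outcome is a pair `(x, g)`. The candidates are the elements of the totally ordered set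
`Fin N`, a larger element being a better candidate; `x t` is the candidate observed at time `t` and
`g t` is the group of that candidate. Time `t : Fin N` is the step number `t + 1` in `1, …, N`. -/
abbrev Outcome (N K : ℕ) : Type := Equiv.Perm (Fin N) × (Fin N → Fin K)

/-- The law of the group of a single candidate: group `k` has probability `lam k`. -/
noncomputable def groupLaw {K : ℕ} (lam : Fin K → ℝ) : Measure (Fin K) :=
  ∑ k, ENNReal.ofReal (lam k) • Measure.dirac k

/-- The arrival order is uniformly random, the groups of the candidates are independent with law
`groupLaw lam`, and they are independent of the arrival order. -/
noncomputable def law (N : ℕ) {K : ℕ} (lam : Fin K → ℝ) : Measure (Outcome N K) :=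
  (uniformOn (Set.univ : Set (Equiv.Perm (Fin N)))).prod (Measure.pi fun _ => groupLaw lam)

/-- The rank, at time `t`, of the current candidate among the candidates of its own group observed
so far (rank `1` is the best). -/
def inGroupRank {N K : ℕ} (ω : Outcome N K) (t : Fin N) : ℕ :=
  (Finset.univ.filter fun s : Fin N => s ≤ t ∧ ω.1 t ≤ ω.1 s ∧ ω.2 s = ω.2 t).card

/-- The rank, at time `t`, of the current candidate among all candidates observed so far. -/
def overallRank {N K : ℕ} (ω : Outcome N K) (t : Fin N) : ℕ :=
  (Finset.univ.filter fun s : Fin N => s ≤ t ∧ ω.1 t ≤ ω.1 s).card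

/-- The loop of the single-threshold algorithm with threshold `T`, run with available budget `b`
over a list of times still to come; it returns the time at which it selects a candidate, if any. -/
def loop {N K : ℕ} (T : ℕ) (ω : Outcome N K) : ℕ → List (Fin N) → Option (Fin N)
  | _, [] => none
  | 0, t :: ts =>
      if T ≤ (t : ℕ) + 1 ∧ inGroupRank ω t = 1 then some t else loop T ω 0 ts
  | b + 1, t :: ts =>
      if T ≤ (t : ℕ) + 1 ∧ inGroupRank ω t = 1 then
        (if overallRank ω t = 1 then some t else loop T ω b ts)
      else loop T ω (b + 1) ts

/-- The time at which the single-threshold algorithm with threshold `T` and initial budget `B`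
selects a candidate, if it selects one. -/
def selectedTime {N K : ℕ} (T B : ℕ) (ω : Outcome N K) : Option (Fin N) :=
  loop T ω B (List.finRange N)

/-- The algorithm succeeds if it selects the best of all `N` candidates. -/
def Succeeds {N K : ℕ} (T B : ℕ) (ω : Outcome N K) : Prop :=
  ∃ t : Fin N, selectedTime T B ω = some t ∧ ∀ s : Fin N, ω.1 s ≤ ω.1 t

/-- The success probability of the single-threshold algorithm with threshold `T` and budget `B`, for
`N` candidates and group proportions `lam`. -/
noncomputable def successProb (N : ℕ) {K : ℕ} (lam : Fin K → ℝ) (T B : ℕ) : ℝ :=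
  (law N lam).real {ω | Succeeds T B ω}

end Secretary

/-! Fix the groups `g` and let only the arrival order be random. Times count from `0`, so threshold
step `T + 1` is time `T`. The algorithm succeeds exactly when the overall best arrives at some `t ≥
T`, the best of its predecessors arrives at some `p < T` (so no overall record occurs in `[T, t)`),
and at most `B` in-group records occur in `[T, t)`, each of which costs one comparison
(`succeeds_iff`).

The pair `(t, p)` has probability `1 / (N t)`. Given it, in-group records at the times in `[T, t)`
behave like independent trials: impossible in the group of `p`, otherwise of probability one over
the number of members of that group so far (`permProb_bestEvent_succ`, by symmetry under swaps
inside a group). Their number is nearly Poisson, with error at most the sum of the squared rates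
(`abs_sub_poissonBelow_le`). The mean is a sum of harmonic differences over the other `K - 1`
groups. If group `j` has density `lam j`, each difference tends to `log (x / α)` for `t ≈ x N`, `T ≈
α N`: the density cancels, so the limit is free of the proportions.

Summing over `p < T` and over `t` gives the integral over `[α, 1]` of `α / x` times the probability
that a Poisson variable of mean `(K - 1) log (x / α)` is at most `B`; `integral_limit` evaluates it.
Finally, random groups almost surely have the right densities by the strong law, and dominated
convergence averages over them. -/

namespace Secretary

/-! ### Events about a uniformly random permutation -/

open Classical in
/-- The probability of an event about a uniformly random permutation of `Fin N`. -/
noncomputable def permProb {N : ℕ} (Q : Equiv.Perm (Fin N) → Prop) : ℝ :=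
  ((Finset.univ.filter Q).card : ℝ) / (N ! : ℝ)

lemma uniformOn_real_eq_permProb {N : ℕ} (Q : Equiv.Perm (Fin N) → Prop) :
    (uniformOn (Set.univ : Set (Equiv.Perm (Fin N)))).real {σ | Q σ} = permProb Q := by
  classical
  have h := uniformOn_univ (Ω := Equiv.Perm (Fin N)) (s := {σ | Q σ})
  rw [Measure.real, h, Measure.count_apply (MeasurableSet.of_discrete), permProb, ENNReal.toReal_div]
  rw [Set.encard_eq_coe_toFinset_card]
  simp [Fintype.card_perm]

lemma permProb_congr {N : ℕ} {Q R : Equiv.Perm (Fin N) → Prop} (h : ∀ σ, Q σ ↔ R σ) :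
    permProb Q = permProb R := by
  rw [funext fun σ => propext (h σ)]

lemma permProb_nonneg {N : ℕ} (Q : Equiv.Perm (Fin N) → Prop) : 0 ≤ permProb Q := by
  unfold permProb; positivity

lemma permProb_mono {N : ℕ} {Q R : Equiv.Perm (Fin N) → Prop} (h : ∀ σ, Q σ → R σ) :
    permProb Q ≤ permProb R := by
  classical
  unfold permProb
  gcongr with σ
  exact h σ

lemma permProb_true (N : ℕ) : permProb (fun _ : Equiv.Perm (Fin N) => True) = 1 := by
  classical
  unfold permProb
  rw [Finset.filter_true, Finset.card_univ, Fintype.card_perm, Fintype.card_fin]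
  exact div_self (by positivity)

lemma permProb_le_one {N : ℕ} (Q : Equiv.Perm (Fin N) → Prop) : permProb Q ≤ 1 :=
  (permProb_mono fun _ _ => trivial).trans (permProb_true N).le

lemma permProb_of_forall_not {N : ℕ} {Q : Equiv.Perm (Fin N) → Prop} (h : ∀ σ, ¬ Q σ) :
    permProb Q = 0 := by
  classical
  unfold permProb
  rw [Finset.filter_false_of_mem fun σ _ => h σ]
  simp

lemma permProb_exists {N : ℕ} {ι : Type*} (I : Finset ι) (Q : ι → Equiv.Perm (Fin N) → Prop)
    (h : ∀ i ∈ I, ∀ j ∈ I, ∀ σ, Q i σ → Q j σ → i = j) :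
    permProb (fun σ => ∃ i ∈ I, Q i σ) = ∑ i ∈ I, permProb (Q i) := by
  classical
  unfold permProb
  rw [← Finset.sum_div, ← Nat.cast_sum, ← Finset.card_biUnion]
  · congr 3
    ext σ
    simp
  · intro i hi j hj hij
    refine Finset.disjoint_left.2 fun σ h1 h2 => hij ?_
    simp only [Finset.mem_filter] at h1 h2
    exact h i hi j hj σ h1.2 h2.2

lemma permProb_and_add_and_not {N : ℕ} (Q R : Equiv.Perm (Fin N) → Prop) :
    permProb (fun σ => Q σ ∧ R σ) + permProb (fun σ => Q σ ∧ ¬ R σ) = permProb Q := by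
  classical
  unfold permProb
  have h := Finset.card_filter_add_card_filter_not (s := Finset.univ.filter Q) R
  rw [Finset.filter_filter, Finset.filter_filter] at h
  rw [← add_div, ← Nat.cast_add, ← h]
  congr!

lemma permProb_comp_mul_right {N : ℕ} (Q : Equiv.Perm (Fin N) → Prop) (τ : Equiv.Perm (Fin N)) :
    permProb (fun σ => Q (σ * τ)) = permProb Q := by
  classical
  unfold permProb
  congr 2
  refine Finset.card_equiv (Equiv.mulRight τ) fun σ => ?_
  simp

/-- If an event is invariant under exchanging positions in `S`, then it is independent of the
position of the maximum over `S`. -/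
lemma permProb_and_isMax {N : ℕ} (Q : Equiv.Perm (Fin N) → Prop) (S : Finset (Fin N))
    {i : Fin N} (hi : i ∈ S)
    (hQ : ∀ a ∈ S, ∀ b ∈ S, ∀ σ, Q σ → Q (σ * Equiv.swap a b)) :
    permProb (fun σ => Q σ ∧ ∀ j ∈ S, σ j ≤ σ i) = permProb Q / S.card := by
  have hsym : ∀ k ∈ S, permProb (fun σ => Q σ ∧ ∀ j ∈ S, σ j ≤ σ k)
      = permProb (fun σ => Q σ ∧ ∀ j ∈ S, σ j ≤ σ i) := by
    intro k hk
    rw [← permProb_comp_mul_right _ (Equiv.swap i k)]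
    refine permProb_congr fun σ => and_congr ⟨fun h => ?_, hQ i hi k hk σ⟩ ?_
    -- A swap is an involution, so invariance in one direction gives the other.
    · simpa [mul_assoc] using hQ i hi k hk _ h
    · have hS : ∀ j, j ∈ S → Equiv.swap i k j ∈ S := by
        intro j hj
        rw [Equiv.swap_apply_def]
        split_ifs <;> assumption
      simp only [Equiv.Perm.mul_apply, Equiv.swap_apply_right]
      refine ⟨fun h j hj => ?_, fun h j hj => h _ (hS j hj)⟩
      simpa using h _ (hS j hj)
  have hsum : permProb Q = ∑ k ∈ S, permProb (fun σ => Q σ ∧ ∀ j ∈ S, σ j ≤ σ k) := by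
    rw [← permProb_exists]
    · refine permProb_congr fun σ => ⟨fun h => ?_, fun ⟨k, _, h, _⟩ => h⟩
      obtain ⟨k, hk, hmax⟩ := Finset.exists_max_image S σ ⟨i, hi⟩
      exact ⟨k, hk, h, hmax⟩
    · intro a ha b hb σ h1 h2
      exact σ.injective (le_antisymm (h2.2 a ha) (h1.2 b hb))
  rw [hsum, Finset.sum_congr rfl hsym, Finset.sum_const, nsmul_eq_mul, mul_comm,
    mul_div_assoc, div_self, mul_one]
  exact_mod_cast (Finset.card_pos.2 ⟨i, hi⟩).ne'

/-! ### Records inside the groups -/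

/-- The candidate arriving at time `r` is the best of its own group so far. -/
def IsRecord {N K : ℕ} (g : Fin N → Fin K) (σ : Equiv.Perm (Fin N)) (r : Fin N) : Prop :=
  ∀ j ≤ r, g j = g r → σ j ≤ σ r

open Classical in
/-- The number of records inside the groups at the times `s, …, t - 1`. -/
noncomputable def recordCount {N K : ℕ} (g : Fin N → Fin K) (σ : Equiv.Perm (Fin N)) (s : ℕ)
    (t : Fin N) : ℕ :=
  (Finset.univ.filter fun r : Fin N => s ≤ (r : ℕ) ∧ r < t ∧ IsRecord g σ r).card

open Classical in
lemma recordCount_eq_succ_add {N K : ℕ} (g : Fin N → Fin K) (σ : Equiv.Perm (Fin N)) (s t : Fin N)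
    (hst : s < t) :
    recordCount g σ s t = recordCount g σ (s + 1) t + if IsRecord g σ s then 1 else 0 := by
  have h : (Finset.univ.filter fun r : Fin N => (s : ℕ) ≤ (r : ℕ) ∧ r < t ∧ IsRecord g σ r)
      = (Finset.univ.filter fun r : Fin N => (s : ℕ) + 1 ≤ (r : ℕ) ∧ r < t ∧ IsRecord g σ r)
        ∪ (if IsRecord g σ s then {s} else ∅) := by
    ext r
    have : (s : ℕ) ≤ r ↔ (s : ℕ) + 1 ≤ r ∨ r = s := by
      rw [Fin.ext_iff]; omega
    simp only [Finset.mem_filter, Finset.mem_univ, true_and, Finset.mem_union, this]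
    split_ifs with hr
    · simp only [Finset.mem_singleton]
      constructor
      · tauto
      · rintro (h | rfl)
        · tauto
        · exact ⟨Or.inr rfl, hst, hr⟩
    · simp only [Finset.notMem_empty, or_false]
      constructor
      · rintro ⟨h | rfl, h2⟩
        · tauto
        · tauto
      · tauto
  rw [recordCount, recordCount, h, Finset.card_union_of_disjoint]
  · congr 1
    split_ifs <;> simp
  · split_ifs <;> simp

lemma recordCount_self {N K : ℕ} (g : Fin N → Fin K) (σ : Equiv.Perm (Fin N)) (t : Fin N) :
    recordCount g σ t t = 0 := by
  classical
  rw [recordCount, Finset.card_eq_zero, Finset.filter_eq_empty_iff]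
  rintro r - ⟨h1, h2, -⟩
  exact absurd h2 (not_lt.2 h1)

/-- The best candidate arrives at time `t`, the best of its predecessors at time `p`, and fewer than
`b` records inside the groups occur at the times `s, …, t - 1`. -/
def BestEvent {N K : ℕ} (g : Fin N → Fin K) (t p : Fin N) (s b : ℕ) (σ : Equiv.Perm (Fin N)) :
    Prop :=
  (∀ j, σ j ≤ σ t) ∧ (∀ j < t, σ j ≤ σ p) ∧ recordCount g σ s t < b

/-- Rearranging the positions up to `s` within groups, with `p` fixed, does not change which
candidates of each group have been seen by a time after `s`. Later records, the best candidate and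
its best predecessor are therefore untouched. It is applied to swaps inside the group of `s`. -/
lemma bestEvent_mul {N K : ℕ} {g : Fin N → Fin K} {t p s : Fin N} {b : ℕ}
    {σ τ : Equiv.Perm (Fin N)} (hst : s < t) (h1 : ∀ j, g (τ j) = g j) (h2 : ∀ j, s < j → τ j = j)
    (h3 : ∀ j ≤ s, τ j ≤ s) (hp : τ p = p) (h : BestEvent g t p (s + 1) b σ) :
    BestEvent g t p (s + 1) b (σ * τ) := by
  classical
  have hle : ∀ r, s < r → ∀ j ≤ r, τ j ≤ r := by
    intro r hr j hj
    rcases le_or_gt j s with hjs | hjs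
    · exact (h3 j hjs).trans hr.le
    · rwa [h2 j hjs]
  have hlt : ∀ r, s < r → ∀ j < r, τ j < r := by
    intro r hr j hj
    rcases le_or_gt j s with hjs | hjs
    · exact (h3 j hjs).trans_lt hr
    · rwa [h2 j hjs]
  refine ⟨fun j => ?_, fun j hj => ?_, lt_of_le_of_lt (Finset.card_le_card ?_) h.2.2⟩
  · simpa [h2 t hst] using h.1 (τ j)
  · simpa [hp] using h.2.1 (τ j) (hlt t hst j hj)
  · intro r
    simp only [Finset.mem_filter, Finset.mem_univ, true_and]
    rintro ⟨hr, hrt, hrec⟩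
    have hsr : s < r := hr
    refine ⟨hr, hrt, fun j hj hg => ?_⟩
    obtain ⟨i, rfl⟩ := τ.surjective j
    have hi : i ≤ r := by
      by_contra hi
      rw [h2 i (hsr.trans (not_le.1 hi))] at hj
      exact hi hj
    have := hrec i hi (by rw [← h1 i, hg])
    simpa [h2 r hsr] using this

/-- The number of candidates of group `k` among the first `m`. -/
def groupCount {K : ℕ} (g : ℕ → Fin K) (k : Fin K) (m : ℕ) : ℕ :=
  ((Finset.range m).filter fun j => g j = k).card

lemma card_filter_le_eq_groupCount {N K : ℕ} (g : ℕ → Fin K) (k : Fin K) (s : Fin N) :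
    (Finset.univ.filter fun j : Fin N => j ≤ s ∧ g j = k).card = groupCount g k (s + 1) := by
  rw [groupCount]
  refine Finset.card_bij (fun j _ => (j : ℕ)) ?_ (fun a _ b _ h => Fin.ext h) ?_
  · intro j hj
    rw [Finset.mem_filter] at hj ⊢
    exact ⟨Finset.mem_range.2 (Nat.lt_succ_of_le hj.2.1), hj.2.2⟩
  · intro j hj
    rw [Finset.mem_filter, Finset.mem_range] at hj
    exact ⟨⟨j, by omega⟩, Finset.mem_filter.2
      ⟨Finset.mem_univ _, Nat.lt_succ_iff.1 hj.1, hj.2⟩, rfl⟩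

/-- The probability of a record at time `s`, given that the best predecessor is in group `k`. -/
noncomputable def recordRate {K : ℕ} (g : ℕ → Fin K) (k : Fin K) (s : ℕ) : ℝ :=
  if g s = k then 0 else 1 / (groupCount g (g s) (s + 1) : ℝ)

lemma permProb_bestEvent_zero {N K : ℕ} (g : Fin N → Fin K) (t p : Fin N) (s : ℕ) :
    permProb (BestEvent g t p s 0) = 0 :=
  permProb_of_forall_not fun _ h => absurd h.2.2 (Nat.not_lt_zero _)

/-- Whether time `s` is a record is independent of everything counted from `s + 1` on. This is the
recursion of independent trials, unrolled from the front. -/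
lemma permProb_bestEvent_succ {N K : ℕ} (g : ℕ → Fin K) {t p s : Fin N} (hps : p < s) (hst : s < t)
    (b : ℕ) :
    permProb (BestEvent (fun i : Fin N => g i) t p s (b + 1)) =
      (1 - recordRate g (g p) s) * permProb (BestEvent (fun i : Fin N => g i) t p (s + 1) (b + 1))
      + recordRate g (g p) s * permProb (BestEvent (fun i : Fin N => g i) t p (s + 1) b) := by
  classical
  set G : Fin N → Fin K := fun i => g i with hG
  have key : ∀ c, permProb (fun σ => BestEvent G t p (s + 1) c σ ∧ IsRecord G σ s)
      = recordRate g (g p) s * permProb (BestEvent G t p (s + 1) c) := by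
    intro c
    unfold recordRate
    split_ifs with hsp
    -- In the group of `p`, a record at `s` would have to beat the best predecessor of `t`.
    · rw [zero_mul]
      refine permProb_of_forall_not fun σ h => ?_
      have h1 := h.2 p hps.le hsp.symm
      have h2 := h.1.2.1 s hst
      exact hps.ne (σ.injective (le_antisymm h1 h2))
    -- Otherwise `p` is outside the group of `s`, so swaps inside that group fix `p` and preserve
    -- the event.
    · have := permProb_and_isMax (BestEvent G t p (s + 1) c)
        (Finset.univ.filter fun j : Fin N => j ≤ s ∧ g j = g s) (i := s) (by simp) ?_
      · rw [card_filter_le_eq_groupCount] at this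
        rw [one_div_mul_eq_div, ← this]
        refine permProb_congr fun σ => ?_
        simp only [IsRecord, hG, Finset.mem_filter, Finset.mem_univ, true_and, and_imp]
      · intro x hx y hy σ h
        simp only [Finset.mem_filter, Finset.mem_univ, true_and] at hx hy
        refine bestEvent_mul hst ?_ ?_ ?_ ?_ h
        · intro j
          rw [Equiv.swap_apply_def]
          split_ifs with h1 h2
          · rw [h1]; exact hy.2.trans hx.2.symm
          · rw [h2]; exact hx.2.trans hy.2.symm
          · rfl
        · intro j hj
          exact Equiv.swap_apply_of_ne_of_ne (by rintro rfl; exact absurd hx.1 (not_le.2 hj))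
            (by rintro rfl; exact absurd hy.1 (not_le.2 hj))
        · intro j hj
          rw [Equiv.swap_apply_def]
          split_ifs
          · exact hy.1
          · exact hx.1
          · exact hj
        · exact Equiv.swap_apply_of_ne_of_ne (by rintro rfl; exact hsp hx.2.symm)
            (by rintro rfl; exact hsp hy.2.symm)
  rw [← permProb_and_add_and_not _ (fun σ => IsRecord G σ s)]
  have e1 : permProb (fun σ => BestEvent G t p s (b + 1) σ ∧ IsRecord G σ s)
      = permProb (fun σ => BestEvent G t p (s + 1) b σ ∧ IsRecord G σ s) := by
    refine permProb_congr fun σ => and_congr_left fun h => ?_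
    simp only [BestEvent, recordCount_eq_succ_add G σ s t hst, if_pos h, Nat.add_lt_add_iff_right]
  have e2 : permProb (fun σ => BestEvent G t p s (b + 1) σ ∧ ¬ IsRecord G σ s)
      = permProb (fun σ => BestEvent G t p (s + 1) (b + 1) σ ∧ ¬ IsRecord G σ s) := by
    refine permProb_congr fun σ => and_congr_left fun h => ?_
    simp only [BestEvent, recordCount_eq_succ_add G σ s t hst, if_neg h, Nat.add_zero]
  have e3 := permProb_and_add_and_not (BestEvent G t p (s + 1) (b + 1)) (fun σ => IsRecord G σ s)
  rw [key] at e3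
  rw [e1, e2, key]
  linarith

/-- No times remain to be counted. The best is at `t` with probability `1 / N`, and independently
the best of the `t` predecessors is at `p` with probability `1 / t`. -/
lemma permProb_bestEvent_self {N K : ℕ} (g : Fin N → Fin K) {t p : Fin N} (hpt : p < t) (b : ℕ) :
    permProb (BestEvent g t p t (b + 1)) = 1 / ((N : ℝ) * (t : ℝ)) := by
  have h1 := permProb_and_isMax (fun _ : Equiv.Perm (Fin N) => True) Finset.univ
    (Finset.mem_univ t) (fun _ _ _ _ _ _ => trivial)
  have h2 := permProb_and_isMax (fun σ : Equiv.Perm (Fin N) => ∀ j, σ j ≤ σ t) (Finset.Iio t)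
    (i := p) (by simpa using hpt) ?_
  · rw [permProb_true, Finset.card_univ, Fintype.card_fin] at h1
    simp only [true_and, Finset.mem_univ, true_imp_iff] at h1
    rw [h1, Fin.card_Iio, div_div] at h2
    rw [← h2]
    refine permProb_congr fun σ => ?_
    simp [BestEvent, recordCount_self]
  · intro a ha b hb σ h j
    have : Equiv.swap a b t = t := Equiv.swap_apply_of_ne_of_ne
      (Finset.mem_Iio.1 ha).ne' (Finset.mem_Iio.1 hb).ne'
    simpa [this] using h (Equiv.swap a b j)

/-! ### The loop of the algorithm -/

lemma inGroupRank_eq_one_iff {N K : ℕ} (ω : Outcome N K) (t : Fin N) :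
    inGroupRank ω t = 1 ↔ IsRecord ω.2 ω.1 t := by
  rw [inGroupRank, Finset.card_eq_one]
  constructor
  · rintro ⟨a, ha⟩ j hj hg
    by_contra hlt
    have h1 : t ∈ ({a} : Finset (Fin N)) := by rw [← ha]; simp
    have h2 : j ∈ ({a} : Finset (Fin N)) := by rw [← ha]; simp [hj, hg, (not_le.1 hlt).le]
    rw [Finset.mem_singleton] at h1 h2
    exact hlt (by rw [h1, h2])
  · intro h
    refine ⟨t, ?_⟩
    ext j
    simp only [Finset.mem_filter, Finset.mem_univ, true_and, Finset.mem_singleton]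
    constructor
    · rintro ⟨h1, h2, h3⟩
      exact ω.1.injective (le_antisymm (h j h1 h3) h2)
    · rintro rfl
      simp

lemma overallRank_eq_one_iff {N K : ℕ} (ω : Outcome N K) (t : Fin N) :
    overallRank ω t = 1 ↔ ∀ j ≤ t, ω.1 j ≤ ω.1 t := by
  rw [overallRank, Finset.card_eq_one]
  constructor
  · rintro ⟨a, ha⟩ j hj
    by_contra hlt
    have h1 : t ∈ ({a} : Finset (Fin N)) := by rw [← ha]; simp
    have h2 : j ∈ ({a} : Finset (Fin N)) := by rw [← ha]; simp [hj, (not_le.1 hlt).le]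
    rw [Finset.mem_singleton] at h1 h2
    exact hlt (by rw [h1, h2])
  · intro h
    refine ⟨t, ?_⟩
    ext j
    simp only [Finset.mem_filter, Finset.mem_univ, true_and, Finset.mem_singleton]
    constructor
    · rintro ⟨h1, h2⟩
      exact ω.1.injective (le_antisymm (h j h1) h2)
    · rintro rfl
      simp

/-- When the algorithm selects a candidate that is the best so far. -/
lemma loop_eq_some_iff {N K : ℕ} (T : ℕ) (ω : Outcome N K) (t : Fin N)
    (hov : overallRank ω t = 1) (hrec : inGroupRank ω t = 1) :
    ∀ (l : List (Fin N)) (b : ℕ), l.Pairwise (· < ·) → t ∈ l →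
      (loop T ω b l = some t ↔ T ≤ (t : ℕ) + 1 ∧
        l.countP (fun r => decide (r < t ∧ T ≤ (r : ℕ) + 1 ∧ inGroupRank ω r = 1)) ≤ b ∧
        ∀ r ∈ l, r < t → T ≤ (r : ℕ) + 1 → inGroupRank ω r = 1 → overallRank ω r ≠ 1) := by
  intro l
  induction l with
  | nil => intro b _ h; simp at h
  | cons a l ih =>
    intro b hl hmem
    rw [List.pairwise_cons] at hl
    rcases List.mem_cons.1 hmem with rfl | htl
    · have h0 : (t :: l).countP
          (fun r => decide (r < t ∧ T ≤ (r : ℕ) + 1 ∧ inGroupRank ω r = 1)) = 0 := by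
        rw [List.countP_eq_zero]
        intro r hr
        rcases List.mem_cons.1 hr with rfl | hr
        · simp
        · simp [(hl.1 r hr).le]
      have h1 : ∀ r ∈ t :: l, r < t → T ≤ (r : ℕ) + 1 → inGroupRank ω r = 1 →
          overallRank ω r ≠ 1 := by
        intro r hr hrt
        rcases List.mem_cons.1 hr with rfl | hr
        · exact absurd hrt (lt_irrefl _)
        · exact absurd hrt (not_lt.2 (hl.1 r hr).le)
      -- Only times after `t` remain in the list, so `t` cannot be selected once it has been passed.
      have hnot : ¬ T ≤ (t : ℕ) + 1 → ∀ (l : List (Fin N)) (b : ℕ), (∀ r ∈ l, t < r) →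
          loop T ω b l ≠ some t := by
        intro _ l
        induction l with
        | nil => intro b _; cases b <;> simp [loop]
        | cons c l ih2 =>
          intro b hc
          have hct := hc c (by simp)
          have hc2 : ∀ r ∈ l, t < r := fun r hr => hc r (by simp [hr])
          cases b <;> simp only [loop] <;> split_ifs <;>
            first
            | exact ih2 _ hc2
            | (simp only [ne_eq, Option.some.injEq]; exact hct.ne')
      rw [h0]
      by_cases hT : T ≤ (t : ℕ) + 1
      · cases b <;> simp [loop, hT, hrec, hov] <;> exact fun r hr hrt =>
          absurd hrt (not_lt.2 (hl.1 r hr).le)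
      · have := hnot hT l b hl.1
        cases b <;> simpa [loop, hT] using this
    · have hat := hl.1 t htl
      by_cases hc : T ≤ (a : ℕ) + 1 ∧ inGroupRank ω a = 1
      · rw [List.countP_cons_of_pos (by simp [hat, hc.1, hc.2])]
        cases b with
        -- Without budget the earlier record `a` is selected, and the count on the right exceeds
        -- `0`.
        | zero => simp [loop, hc, hat.ne]
        | succ b =>
          by_cases ho : overallRank ω a = 1
          · simp only [loop, hc, ho, and_self, if_true]
            constructor
            · intro h; exact absurd (Option.some.inj h) hat.ne
            · rintro ⟨-, -, h⟩
              exact absurd ho (h a (by simp) hat hc.1 hc.2)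
          · simp only [loop, hc, ho, and_self, if_true, if_false]
            rw [ih b hl.2 htl]
            simp [ho]
      · rw [List.countP_cons_of_neg (by simp only [decide_eq_true_eq]; tauto)]
        have : loop T ω b (a :: l) = loop T ω b l := by cases b <;> simp only [loop, hc, if_false]
        rw [this, ih b hl.2 htl]
        simp only [List.forall_mem_cons]
        tauto

/-- A description of the success event in terms of the best candidate and its best predecessor. -/
lemma succeeds_iff {N K T : ℕ} (hT : 1 ≤ T) (B : ℕ) (ω : Outcome N K) :
    Succeeds (T + 1) B ω ↔ ∃ i ∈ Finset.univ.filter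
      (fun i : Fin N × Fin N => T ≤ (i.1 : ℕ) ∧ (i.2 : ℕ) < T),
      BestEvent ω.2 i.1 i.2 T (B + 1) ω.1 := by
  classical
  have main : ∀ t : Fin N, (∀ s : Fin N, ω.1 s ≤ ω.1 t) →
      (selectedTime (T + 1) B ω = some t ↔ T ≤ (t : ℕ) ∧
        recordCount ω.2 ω.1 T t < B + 1 ∧
        ∀ r : Fin N, r < t → T ≤ (r : ℕ) → ∃ j ≤ r, ω.1 r < ω.1 j) := by
    intro t ht
    have hov : overallRank ω t = 1 := (overallRank_eq_one_iff ω t).2 fun j _ => ht j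
    have hrec : inGroupRank ω t = 1 := (inGroupRank_eq_one_iff ω t).2 fun j _ _ => ht j
    rw [selectedTime, loop_eq_some_iff _ ω t hov hrec _ _ (List.pairwise_lt_finRange N)
      (List.mem_finRange t)]
    refine and_congr (by omega) (and_congr ?_ ?_)
    · rw [Nat.lt_succ_iff, recordCount, List.countP_eq_length_filter]
      have : (Finset.univ.filter fun r : Fin N => T ≤ (r : ℕ) ∧ r < t ∧ IsRecord ω.2 ω.1 r).card
          = ((List.finRange N).filter
            (fun r => decide (r < t ∧ T + 1 ≤ (r : ℕ) + 1 ∧ inGroupRank ω r = 1))).length := by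
        rw [← List.toFinset_card_of_nodup ((List.nodup_finRange N).filter _)]
        congr 1
        ext r
        simp only [Finset.mem_filter, Finset.mem_univ, true_and, List.mem_toFinset,
          List.mem_filter, List.mem_finRange, decide_eq_true_eq, inGroupRank_eq_one_iff]
        have : T ≤ (r : ℕ) ↔ T + 1 ≤ (r : ℕ) + 1 := by omega
        tauto
      rw [this]
    · refine forall_congr' fun r => ?_
      simp only [List.mem_finRange, true_imp_iff, Nat.add_le_add_iff_right]
      refine imp_congr_right fun h1 => imp_congr_right fun h2 => ?_
      -- An overall record is also an in-group record, so the in-group condition can be dropped.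
      rw [Ne, overallRank_eq_one_iff, inGroupRank_eq_one_iff]
      push Not
      constructor
      · intro h
        by_contra hcon
        push Not at hcon
        obtain ⟨j, hj, hlt⟩ := h fun j hj _ => hcon j hj
        exact absurd (hcon j hj) (not_le.2 hlt)
      · exact fun h _ => h
  constructor
  · rintro ⟨t, hsel, hmax⟩
    obtain ⟨h1, h2, h3⟩ := (main t hmax).1 hsel
    -- Since `1 ≤ T ≤ t`, there is a predecessor.
    obtain ⟨p, hp, hpmax⟩ := Finset.exists_max_image (Finset.Iio t) ω.1
      ⟨⟨0, by omega⟩, by simp [Fin.lt_def]; omega⟩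
    rw [Finset.mem_Iio] at hp
    refine ⟨(t, p), ?_, hmax, fun j hj => hpmax j (by simpa using hj), h2⟩
    simp only [Finset.mem_filter, Finset.mem_univ, true_and]
    refine ⟨h1, ?_⟩
    by_contra hTp
    obtain ⟨j, hj, hlt⟩ := h3 p hp (not_lt.1 hTp)
    exact absurd (hpmax j (by simpa using hj.trans_lt hp)) (not_le.2 hlt)
  · rintro ⟨⟨t, p⟩, hi, hmax, hp, hcount⟩
    simp only [Finset.mem_filter, Finset.mem_univ, true_and] at hi hmax hp hcount
    refine ⟨t, (main t hmax).2 ⟨hi.1, hcount, fun r hr hTr => ⟨p, ?_, ?_⟩⟩, hmax⟩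
    · rw [Fin.le_def]; omega
    · refine lt_of_le_of_ne (hp r hr) fun h => ?_
      have := ω.1.injective h
      rw [this] at hTr
      omega

lemma permProb_succeeds {N K T : ℕ} (hT : 1 ≤ T) (B : ℕ) (g : Fin N → Fin K) :
    permProb (fun σ => Succeeds (T + 1) B (σ, g)) =
      ∑ t : Fin N, if T ≤ (t : ℕ) then
        ∑ p : Fin N, (if (p : ℕ) < T then permProb (BestEvent g t p T (B + 1)) else 0) else 0 := by
  rw [permProb_congr fun σ => succeeds_iff hT B (σ, g)]
  rw [permProb_exists _ (fun (i : Fin N × Fin N) σ => BestEvent g i.1 i.2 T (B + 1) σ)]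
  · rw [Finset.sum_filter, Fintype.sum_prod_type]
    refine Finset.sum_congr rfl fun t _ => ?_
    split_ifs with h <;> simp [h]
  · rintro ⟨t, p⟩ h1 ⟨t', p'⟩ h2 σ e1 e2
    simp only [Finset.mem_filter, Finset.mem_univ, true_and] at h1 h2 e1 e2
    have ht : t = t' := σ.injective (le_antisymm (e2.1 t) (e1.1 t'))
    subst ht
    have hp : p = p' := σ.injective (le_antisymm
      (e2.2.1 p (by rw [Fin.lt_def]; omega)) (e1.2.1 p' (by rw [Fin.lt_def]; omega)))
    rw [hp]

/-! ### Poisson approximation -/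

/-- The probability that a Poisson variable of mean `l` equals `b`. -/
noncomputable def poissonMass (l : ℝ) (b : ℕ) : ℝ := Real.exp (-l) * (l ^ b / (b ! : ℝ))

/-- The probability that a Poisson variable of mean `l` is smaller than `b`. -/
noncomputable def poissonBelow (l : ℝ) (b : ℕ) : ℝ := ∑ i ∈ Finset.range b, poissonMass l i

lemma poissonMass_nonneg {l : ℝ} (hl : 0 ≤ l) (b : ℕ) : 0 ≤ poissonMass l b := by
  unfold poissonMass; positivity

lemma poissonMass_le_one {l : ℝ} (hl : 0 ≤ l) (b : ℕ) : poissonMass l b ≤ 1 := by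
  unfold poissonMass
  calc _ ≤ Real.exp (-l) * Real.exp l := by
        gcongr
        exact Real.pow_div_factorial_le_exp l hl b
    _ = 1 := by rw [← Real.exp_add]; simp

lemma hasDerivAt_poissonMass_zero (l : ℝ) :
    HasDerivAt (fun l => poissonMass l 0) (-poissonMass l 0) l := by
  have := (hasDerivAt_neg l).exp
  simpa [poissonMass] using this

lemma hasDerivAt_poissonMass_succ (l : ℝ) (b : ℕ) :
    HasDerivAt (fun l => poissonMass l (b + 1)) (poissonMass l b - poissonMass l (b + 1)) l := by
  have h := (hasDerivAt_neg l).exp.mul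
    ((hasDerivAt_pow (b + 1) l).div_const (((b + 1)! : ℕ) : ℝ))
  refine h.congr_deriv ?_
  simp only [poissonMass, Nat.factorial_succ]
  push_cast
  have : (b : ℝ) + 1 ≠ 0 := by positivity
  have : (b ! : ℝ) ≠ 0 := by positivity
  field_simp
  ring_nf

/-- The derivative is a difference of two masses in `[0, 1]`, or minus one such mass, so its
absolute value is at most `1`. -/
lemma abs_poissonMass_sub_le {l x : ℝ} (hl : 0 ≤ l) (hx : 0 ≤ x) (b : ℕ) :
    |poissonMass (l + x) b - poissonMass l b| ≤ x := by
  have hd : ∀ y : ℝ, ∃ d, HasDerivAt (fun l => poissonMass l b) d y ∧ (0 ≤ y → |d| ≤ 1) := by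
    intro y
    cases b with
    | zero =>
      refine ⟨_, hasDerivAt_poissonMass_zero y, fun hy => ?_⟩
      rw [abs_neg, abs_of_nonneg (poissonMass_nonneg hy 0)]
      exact poissonMass_le_one hy 0
    | succ b =>
      refine ⟨_, hasDerivAt_poissonMass_succ y b, fun hy => ?_⟩
      rw [abs_le]
      constructor <;> linarith [poissonMass_nonneg hy b, poissonMass_le_one hy b,
        poissonMass_nonneg hy (b + 1), poissonMass_le_one hy (b + 1)]
  choose d hd hd1 using hd
  have := Convex.norm_image_sub_le_of_norm_hasDerivWithin_le (s := Set.Ici (0 : ℝ))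
    (f := fun l => poissonMass l b) (f' := d) (C := 1) (fun y _ => (hd y).hasDerivWithinAt)
    (fun y hy => hd1 y hy) (convex_Ici 0) (x := l) (y := l + x) hl
    (by simp only [Set.mem_Ici]; positivity)
  simpa [abs_of_nonneg hx] using this

lemma hasDerivAt_poissonBelow (l : ℝ) (b : ℕ) :
    HasDerivAt (fun l => poissonBelow l (b + 1)) (-poissonMass l b) l := by
  induction b with
  | zero => simpa [poissonBelow] using hasDerivAt_poissonMass_zero l
  | succ b ih =>
    have h := ih.add (hasDerivAt_poissonMass_succ l b)
    have e : (fun l => poissonBelow l (b + 1 + 1))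
        = (fun l => poissonBelow l (b + 1)) + fun l => poissonMass l (b + 1) := by
      funext y
      simp [poissonBelow, Finset.sum_range_succ _ (b + 1)]
    rw [e]
    exact h.congr_deriv (by ring)

lemma continuous_poissonBelow (b : ℕ) : Continuous fun l => poissonBelow l b := by
  unfold poissonBelow poissonMass
  fun_prop

/-- The cost of replacing one trial of probability `x` by a Poisson variable of mean `x`. The
mixture is the first-order expansion of `poissonBelow (l + x) (b + 1)` at `l`; the remainder has
derivative at most `x` in absolute value on `[0, x]`. -/
lemma abs_poissonBelow_step_le {l x : ℝ} (hl : 0 ≤ l) (hx : 0 ≤ x) (b : ℕ) :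
    |(1 - x) * poissonBelow l (b + 1) + x * poissonBelow l b - poissonBelow (l + x) (b + 1)|
      ≤ x ^ 2 := by
  have hd : ∀ y ∈ Set.Icc (0 : ℝ) x, HasDerivWithinAt
      (fun y => poissonBelow (l + y) (b + 1) + y * poissonMass l b)
      (-poissonMass (l + y) b + poissonMass l b) (Set.Icc 0 x) y := by
    intro y _
    have h1 := (hasDerivAt_poissonBelow (l + y) b).comp_const_add l y
    have h2 := (hasDerivAt_id y).mul_const (poissonMass l b)
    exact ((h1.add h2).congr_deriv (by simp)).hasDerivWithinAt
  have := Convex.norm_image_sub_le_of_norm_hasDerivWithin_le hd (C := x) (fun y hy => ?_)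
    (convex_Icc 0 x) (x := 0) (y := x) (by simp [hx]) (by simp [hx])
  · have e : (1 - x) * poissonBelow l (b + 1) + x * poissonBelow l b - poissonBelow (l + x) (b + 1)
        = -(poissonBelow (l + x) (b + 1) + x * poissonMass l b - poissonBelow l (b + 1)) := by
      rw [poissonBelow, poissonBelow, Finset.sum_range_succ]
      ring
    rw [e, abs_neg, sq]
    simpa [abs_of_nonneg hx] using this
  · have := abs_poissonMass_sub_le hl hy.1 b
    rw [Real.norm_eq_abs, neg_add_eq_sub, abs_sub_comm]
    exact this.trans hy.2

/-- The number of successes in independent trials with success probabilities `p s, …, p (t - 1)` is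
approximately Poisson. -/
lemma abs_sub_poissonBelow_le {D : ℕ → ℕ → ℝ} {p : ℕ → ℝ} {C : ℝ} (hC : 0 ≤ C) {s₀ t : ℕ}
    (hp0 : ∀ s, 0 ≤ p s) (hp1 : ∀ s, p s ≤ 1) (hD0 : ∀ s, D s 0 = 0)
    (hDt : ∀ b, D t (b + 1) = C)
    (hD : ∀ s, s₀ ≤ s → s < t → ∀ b,
      D s (b + 1) = (1 - p s) * D (s + 1) (b + 1) + p s * D (s + 1) b)
    (hst : s₀ ≤ t) (b : ℕ) :
    |D s₀ b - C * poissonBelow (∑ r ∈ Finset.Ico s₀ t, p r) b|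
      ≤ C * ∑ r ∈ Finset.Ico s₀ t, p r ^ 2 := by
  revert b
  refine Nat.decreasingInduction' (P := fun s => ∀ b,
    |D s b - C * poissonBelow (∑ r ∈ Finset.Ico s t, p r) b|
      ≤ C * ∑ r ∈ Finset.Ico s t, p r ^ 2) ?_ hst ?_
  · intro s hst hs ih b
    have hsq : 0 ≤ C * ∑ r ∈ Finset.Ico s t, p r ^ 2 :=
      mul_nonneg hC (Finset.sum_nonneg fun _ _ => sq_nonneg _)
    cases b with
    | zero => simpa [hD0, poissonBelow] using hsq
    | succ b =>
      rw [Finset.sum_eq_sum_Ico_succ_bot hst, Finset.sum_eq_sum_Ico_succ_bot hst, hD s hs hst,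
        add_comm (p s)]
      set L := ∑ r ∈ Finset.Ico (s + 1) t, p r
      set E := ∑ r ∈ Finset.Ico (s + 1) t, p r ^ 2
      have hL : 0 ≤ L := Finset.sum_nonneg fun _ _ => hp0 _
      have h1 := ih (b + 1)
      have h2 := ih b
      have h3 := abs_poissonBelow_step_le hL (hp0 s) b
      have hq : 0 ≤ 1 - p s := sub_nonneg.2 (hp1 s)
      -- A convex combination of the two inductive errors, plus one replacement error.
      have e : (1 - p s) * D (s + 1) (b + 1) + p s * D (s + 1) b
          - C * poissonBelow (L + p s) (b + 1)
          = (1 - p s) * (D (s + 1) (b + 1) - C * poissonBelow L (b + 1))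
            + p s * (D (s + 1) b - C * poissonBelow L b)
            + C * ((1 - p s) * poissonBelow L (b + 1) + p s * poissonBelow L b
              - poissonBelow (L + p s) (b + 1)) := by ring
      rw [e]
      calc _ ≤ (1 - p s) * (C * E) + p s * (C * E) + C * p s ^ 2 := by
            refine (abs_add_three _ _ _).trans ?_
            rw [abs_mul, abs_mul, abs_mul, abs_of_nonneg hq, abs_of_nonneg (hp0 s),
              abs_of_nonneg hC]
            gcongr
            exact hp0 s
        _ = C * (p s ^ 2 + E) := by ring
  · intro b
    cases b with
    | zero => simp [hD0, poissonBelow]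
    | succ b =>
      rw [hDt]
      have : poissonBelow 0 (b + 1) = 1 := by
        rw [poissonBelow, Finset.sum_range_succ']
        simp [poissonMass]
      simp [this]

lemma recordRate_nonneg {K : ℕ} (g : ℕ → Fin K) (k : Fin K) (s : ℕ) : 0 ≤ recordRate g k s := by
  unfold recordRate
  split_ifs <;> positivity

lemma one_le_groupCount {K : ℕ} (g : ℕ → Fin K) (s : ℕ) : 1 ≤ groupCount g (g s) (s + 1) :=
  Finset.card_pos.2 ⟨s, by simp⟩

lemma recordRate_le_one {K : ℕ} (g : ℕ → Fin K) (k : Fin K) (s : ℕ) : recordRate g k s ≤ 1 := by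
  unfold recordRate
  split_ifs
  · exact zero_le_one
  · exact (div_le_one (by exact_mod_cast one_le_groupCount g s)).2
      (by exact_mod_cast one_le_groupCount g s)

lemma abs_permProb_bestEvent_sub_le {N K : ℕ} (g : ℕ → Fin K) {t p : Fin N} {T : ℕ}
    (hpT : (p : ℕ) < T) (hTt : T ≤ (t : ℕ)) (b : ℕ) :
    |permProb (BestEvent (fun i : Fin N => g i) t p T b)
        - 1 / ((N : ℝ) * (t : ℝ)) * poissonBelow (∑ r ∈ Finset.Ico T t, recordRate g (g p) r) b|
      ≤ 1 / ((N : ℝ) * (t : ℝ)) * ∑ r ∈ Finset.Ico T t, recordRate g (g p) r ^ 2 := by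
  refine abs_sub_poissonBelow_le
    (D := fun s b => permProb (BestEvent (fun i : Fin N => g i) t p s b)) (by positivity)
    (recordRate_nonneg g _) (recordRate_le_one g _)
    (fun s => permProb_bestEvent_zero _ t p s)
    (fun b => permProb_bestEvent_self _ (by rw [Fin.lt_def]; omega) b) ?_ hTt b
  intro s hs hst b
  exact permProb_bestEvent_succ g (s := ⟨s, hst.trans t.2⟩) (by rw [Fin.lt_def]; simp; omega)
    (by rw [Fin.lt_def]; exact hst) b

/-! ### Asymptotics for a fixed sequence of groups -/

lemma groupCount_mono {K : ℕ} (g : ℕ → Fin K) (k : Fin K) : Monotone (groupCount g k) :=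
  fun _ _ h => Finset.card_le_card (Finset.filter_subset_filter _ (Finset.range_mono h))

lemma groupCount_succ {K : ℕ} (g : ℕ → Fin K) (k : Fin K) (m : ℕ) :
    groupCount g k (m + 1) = groupCount g k m + if g m = k then 1 else 0 := by
  rw [groupCount, groupCount, Finset.range_add_one, Finset.filter_insert]
  split_ifs <;> simp

/-- At time `r` only the count of group `g r` grows, and its harmonic number rises by the reciprocal
of the new count. In this form the rates telescope. -/
lemma recordRate_eq_sum {K : ℕ} (g : ℕ → Fin K) (k : Fin K) (r : ℕ) :
    recordRate g k r = ∑ j ∈ Finset.univ.erase k,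
      ((harmonic (groupCount g j (r + 1)) : ℝ) - (harmonic (groupCount g j r) : ℝ)) := by
  have h : ∀ j, ((harmonic (groupCount g j (r + 1)) : ℝ) - (harmonic (groupCount g j r) : ℝ))
      = if g r = j then 1 / (groupCount g (g r) (r + 1) : ℝ) else 0 := by
    intro j
    rw [groupCount_succ]
    split_ifs with h
    · rw [harmonic_succ, groupCount_succ, h]
      simp
    · simp
  rw [Finset.sum_congr rfl fun j _ => h j, Finset.sum_ite_eq, recordRate]
  by_cases hk : g r = k <;> simp [hk]

lemma sum_recordRate {K : ℕ} (g : ℕ → Fin K) (k : Fin K) {T t : ℕ} (h : T ≤ t) :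
    ∑ r ∈ Finset.Ico T t, recordRate g k r = ∑ j ∈ Finset.univ.erase k,
      ((harmonic (groupCount g j t) : ℝ) - (harmonic (groupCount g j T) : ℝ)) := by
  rw [Finset.sum_congr rfl fun r _ => recordRate_eq_sum g k r, Finset.sum_comm]
  exact Finset.sum_congr rfl fun j _ =>
    Finset.sum_Ico_sub (fun r => (harmonic (groupCount g j r) : ℝ)) h

/-- Each rate from `T` on is at most the reciprocal of a group count at `T`, which tends to `0` in
the limit. -/
lemma sum_recordRate_sq_le {K : ℕ} (g : ℕ → Fin K) (k : Fin K) {T : ℕ} (t : ℕ)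
    (hT : ∀ j, 0 < groupCount g j T) :
    ∑ r ∈ Finset.Ico T t, recordRate g k r ^ 2
      ≤ (∑ r ∈ Finset.Ico T t, recordRate g k r) * ∑ j, 1 / (groupCount g j T : ℝ) := by
  rw [Finset.sum_mul]
  refine Finset.sum_le_sum fun r hr => ?_
  rw [sq]
  refine mul_le_mul_of_nonneg_left ?_ (recordRate_nonneg g k r)
  have h1 : recordRate g k r ≤ 1 / (groupCount g (g r) T : ℝ) := by
    unfold recordRate
    split_ifs
    · positivity
    · have h2 : groupCount g (g r) T ≤ groupCount g (g r) (r + 1) :=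
        groupCount_mono g _ ((Finset.mem_Ico.1 hr).1.trans (Nat.le_succ r))
      have h3 := hT (g r)
      gcongr
  exact h1.trans (Finset.single_le_sum (f := fun j => 1 / (groupCount g j T : ℝ))
    (fun j _ => by positivity) (Finset.mem_univ _))

/-- The probability that the algorithm selects the best candidate, and that it arrives at time
`t`. -/
noncomputable def bestProb {K : ℕ} (g : ℕ → Fin K) (N T b t : ℕ) : ℝ :=
  if h : t < N ∧ T ≤ t then
    ∑ p : Fin N, (if (p : ℕ) < T then
      permProb (BestEvent (fun i : Fin N => g i) ⟨t, h.1⟩ p T b) else 0)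
  else 0

lemma permProb_succeeds_eq_sum {N K T : ℕ} (hT : 1 ≤ T) (B : ℕ) (g : ℕ → Fin K) :
    permProb (fun σ => Succeeds (T + 1) B (σ, fun i : Fin N => g i)) =
      ∑ t ∈ Finset.range N, bestProb g N T (B + 1) t := by
  rw [permProb_succeeds hT, ← Fin.sum_univ_eq_sum_range]
  refine Finset.sum_congr rfl fun t _ => ?_
  simp [bestProb]

lemma card_filter_val_lt {N T : ℕ} (h : T ≤ N) :
    (Finset.univ.filter fun p : Fin N => (p : ℕ) < T).card = T := by
  simp [Fin.card_filter_val_lt, h]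

lemma bestProb_nonneg {K : ℕ} (g : ℕ → Fin K) (N T b t : ℕ) : 0 ≤ bestProb g N T b t := by
  unfold bestProb
  split_ifs
  · refine Finset.sum_nonneg fun p _ => ?_
    split_ifs
    · exact permProb_nonneg _
    · exact le_rfl
  · exact le_rfl

/-- Forgetting the record count leaves `T` choices of `p`, each of probability `1 / (N t)`, and `T ≤
t`. This is the dominating bound. -/
lemma mul_bestProb_le_one {K : ℕ} (g : ℕ → Fin K) (N T b t : ℕ) :
    (N : ℝ) * bestProb g N T b t ≤ 1 := by
  unfold bestProb
  split_ifs with h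
  · rw [← Finset.sum_filter]
    have h1 : ∀ p ∈ Finset.univ.filter (fun p : Fin N => (p : ℕ) < T),
        permProb (BestEvent (fun i : Fin N => g i) ⟨t, h.1⟩ p T b) ≤ 1 / ((N : ℝ) * (t : ℝ)) := by
      intro p hp
      rw [Finset.mem_filter] at hp
      have hpt : p < (⟨t, h.1⟩ : Fin N) := hp.2.trans_le h.2
      refine le_trans (permProb_mono fun σ hσ => ?_)
        (permProb_bestEvent_self (fun i : Fin N => g i) hpt 0).le
      exact ⟨hσ.1, hσ.2.1, by rw [recordCount_self]; exact Nat.zero_lt_one⟩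
    have h2 := Finset.sum_le_sum h1
    rw [Finset.sum_const, card_filter_val_lt (h.2.trans h.1.le), nsmul_eq_mul] at h2
    rcases Nat.eq_zero_or_pos t with rfl | ht
    · have : T = 0 := by omega
      subst this
      simp
    · have hN : (0 : ℝ) < N := by exact_mod_cast lt_trans ht h.1
      have ht' : (0 : ℝ) < t := by exact_mod_cast ht
      have hTt : (T : ℝ) ≤ t := by exact_mod_cast h.2
      calc _ ≤ (N : ℝ) * (T * (1 / (N * t))) := by gcongr
        _ = T / t := by field_simp
        _ ≤ 1 := (div_le_one ht').2 hTt
  · simp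

/-- The Poisson mean depends on `p` only through its group, so summing the errors over all groups
gives a bound uniform in `p`. -/
lemma abs_mul_bestProb_sub_le {K : ℕ} (g : ℕ → Fin K) {N T t : ℕ} (hT : 1 ≤ T) (htN : t < N)
    (hTt : T ≤ t) (b : ℕ) (F : ℝ) :
    |(N : ℝ) * bestProb g N T b t - (T : ℝ) / t * F| ≤
      ∑ k, (|poissonBelow (∑ r ∈ Finset.Ico T t, recordRate g k r) b - F|
        + ∑ r ∈ Finset.Ico T t, recordRate g k r ^ 2) := by
  have hN : (0 : ℝ) < N := by exact_mod_cast Nat.zero_lt_of_lt htN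
  have ht' : (0 : ℝ) < t := by exact_mod_cast lt_of_lt_of_le hT hTt
  have hTt' : (T : ℝ) ≤ t := by exact_mod_cast hTt
  set R := ∑ k, (|poissonBelow (∑ r ∈ Finset.Ico T t, recordRate g k r) b - F|
        + ∑ r ∈ Finset.Ico T t, recordRate g k r ^ 2) with hR
  have hR0 : ∀ k ∈ Finset.univ,
      0 ≤ (|poissonBelow (∑ r ∈ Finset.Ico T t, recordRate g k r) b - F|
        + ∑ r ∈ Finset.Ico T t, recordRate g k r ^ 2) :=
    fun k _ => add_nonneg (abs_nonneg _) (Finset.sum_nonneg fun _ _ => sq_nonneg _)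
  have hc := card_filter_val_lt (hTt.trans htN.le)
  have e : (N : ℝ) * bestProb g N T b t - (T : ℝ) / t * F
      = ∑ p ∈ Finset.univ.filter (fun p : Fin N => (p : ℕ) < T),
        ((N : ℝ) * permProb (BestEvent (fun i : Fin N => g i) ⟨t, htN⟩ p T b) - F / t) := by
    rw [bestProb, dif_pos ⟨htN, hTt⟩, ← Finset.sum_filter, Finset.sum_sub_distrib,
      ← Finset.mul_sum, Finset.sum_const, hc, nsmul_eq_mul]
    ring
  rw [e]
  refine (Finset.abs_sum_le_sum_abs _ _).trans ?_
  have h1 : ∀ p ∈ Finset.univ.filter (fun p : Fin N => (p : ℕ) < T),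
      |(N : ℝ) * permProb (BestEvent (fun i : Fin N => g i) ⟨t, htN⟩ p T b) - F / t|
        ≤ 1 / t * R := by
    intro p hp
    rw [Finset.mem_filter] at hp
    have h := abs_permProb_bestEvent_sub_le g (t := ⟨t, htN⟩) hp.2 hTt b
    simp only at h
    have h3 := Finset.single_le_sum hR0 (Finset.mem_univ (g p))
    rw [← hR] at h3
    set P := permProb (BestEvent (fun i : Fin N => g i) ⟨t, htN⟩ p T b)
    set A := poissonBelow (∑ r ∈ Finset.Ico T t, recordRate g (g p) r) b
    set E := ∑ r ∈ Finset.Ico T t, recordRate g (g p) r ^ 2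
    have e2 : (N : ℝ) * P - F / t = N * (P - 1 / (N * t) * A) + 1 / t * (A - F) := by
      field_simp
      ring
    rw [e2]
    calc _ ≤ N * (1 / (N * t) * E) + 1 / t * |A - F| := by
          refine (abs_add_le _ _).trans ?_
          rw [abs_mul, abs_mul, abs_of_pos hN, abs_of_pos (a := 1 / (t : ℝ)) (by positivity)]
          gcongr
      _ = 1 / t * (|A - F| + E) := by field_simp; ring
      _ ≤ 1 / t * R := by gcongr
  refine (Finset.sum_le_sum h1).trans ?_
  rw [Finset.sum_const, hc, nsmul_eq_mul]
  have : 0 ≤ R := Finset.sum_nonneg hR0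
  calc _ = T / t * R := by ring
    _ ≤ 1 * R := by gcongr; exact (div_le_one ht').2 hTt'
    _ = R := one_mul R

lemma tendsto_atTop_of_tendsto_div {u : ℕ → ℕ} {x : ℝ} (hx : 0 < x)
    (hu : Tendsto (fun N : ℕ => (u N : ℝ) / N) atTop (𝓝 x)) : Tendsto u atTop atTop := by
  have h1 : Tendsto (fun N : ℕ => (u N : ℝ) / N * N) atTop atTop :=
    hu.pos_mul_atTop hx tendsto_natCast_atTop_atTop
  refine tendsto_natCast_atTop_iff.1 (h1.congr' ?_)
  filter_upwards [eventually_gt_atTop 0] with N hN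
  field_simp

/-- Counts along a sequence of times that grows linearly. -/
lemma tendsto_groupCount_div {K : ℕ} {g : ℕ → Fin K} {k : Fin K} {c : ℝ}
    (hg : Tendsto (fun m : ℕ => (groupCount g k m : ℝ) / m) atTop (𝓝 c))
    {u : ℕ → ℕ} {x : ℝ} (hx : 0 < x) (hu : Tendsto (fun N : ℕ => (u N : ℝ) / N) atTop (𝓝 x)) :
    Tendsto (fun N : ℕ => (groupCount g k (u N) : ℝ) / N) atTop (𝓝 (c * x)) := by
  have hu' := tendsto_atTop_of_tendsto_div hx hu
  refine ((hg.comp hu').mul hu).congr' ?_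
  filter_upwards [hu'.eventually_gt_atTop 0] with N hN
  have : (u N : ℝ) ≠ 0 := by positivity
  simp only [Function.comp]
  field_simp

/-- Euler's constant cancels in the difference. -/
lemma tendsto_harmonic_sub_harmonic {u v : ℕ → ℕ} {x y : ℝ} (hx : 0 < x) (hy : 0 < y)
    (hu : Tendsto (fun N : ℕ => (u N : ℝ) / N) atTop (𝓝 x))
    (hv : Tendsto (fun N : ℕ => (v N : ℝ) / N) atTop (𝓝 y)) :
    Tendsto (fun N : ℕ => (harmonic (u N) : ℝ) - (harmonic (v N) : ℝ)) atTop
      (𝓝 (Real.log (x / y))) := by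
  have hu' := tendsto_atTop_of_tendsto_div hx hu
  have hv' := tendsto_atTop_of_tendsto_div hy hv
  have h1 := (Real.tendsto_harmonic_sub_log.comp hu').sub (Real.tendsto_harmonic_sub_log.comp hv')
  have h2 := (hu.log hx.ne').sub (hv.log hy.ne')
  have h3 := h1.add h2
  rw [sub_self, zero_add, ← Real.log_div hx.ne' hy.ne'] at h3
  refine h3.congr' ?_
  filter_upwards [hu'.eventually_gt_atTop 0, hv'.eventually_gt_atTop 0,
    eventually_gt_atTop 0] with N h1 h2 h3
  rw [Real.log_div (by positivity) (by positivity), Real.log_div (by positivity) (by positivity)]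
  simp only [Function.comp]
  ring

/-- Here the proportions disappear: `lam j` scales both counts of group `j` and cancels inside the
logarithm. -/
lemma tendsto_sum_recordRate {K : ℕ} {lam : Fin K → ℝ} (hlam : ∀ k, 0 < lam k) {g : ℕ → Fin K}
    (hg : ∀ k, Tendsto (fun m : ℕ => (groupCount g k m : ℝ) / m) atTop (𝓝 (lam k)))
    {T t : ℕ → ℕ} {α x : ℝ} (hα : 0 < α) (hx : 0 < x)
    (hT : Tendsto (fun N : ℕ => (T N : ℝ) / N) atTop (𝓝 α))
    (ht : Tendsto (fun N : ℕ => (t N : ℝ) / N) atTop (𝓝 x)) (hTt : ∀ᶠ N in atTop, T N ≤ t N)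
    (k : Fin K) :
    Tendsto (fun N => ∑ r ∈ Finset.Ico (T N) (t N), recordRate g k r) atTop
      (𝓝 (((K : ℝ) - 1) * Real.log (x / α))) := by
  have hcard : ((K : ℝ) - 1) * Real.log (x / α)
      = ∑ j ∈ Finset.univ.erase k, Real.log (x / α) := by
    rw [Finset.sum_const, Finset.card_erase_of_mem (Finset.mem_univ k), Finset.card_univ,
      Fintype.card_fin, nsmul_eq_mul, Nat.cast_sub (Nat.one_le_of_lt k.2), Nat.cast_one]
  rw [hcard]
  refine Tendsto.congr' (hTt.mono fun N h => (sum_recordRate g k h).symm)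
    (tendsto_finsetSum _ fun j _ => ?_)
  have := tendsto_harmonic_sub_harmonic (mul_pos (hlam j) hx) (mul_pos (hlam j) hα)
    (tendsto_groupCount_div (hg j) hx ht) (tendsto_groupCount_div (hg j) hα hT)
  rwa [mul_div_mul_left _ _ (hlam j).ne'] at this

lemma tendsto_mul_bestProb {K : ℕ} {lam : Fin K → ℝ} (hlam : ∀ k, 0 < lam k) {g : ℕ → Fin K}
    (hg : ∀ k, Tendsto (fun m : ℕ => (groupCount g k m : ℝ) / m) atTop (𝓝 (lam k)))
    {T t : ℕ → ℕ} {α x : ℝ} (hα : 0 < α) (hαx : α < x)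
    (hT : Tendsto (fun N : ℕ => (T N : ℝ) / N) atTop (𝓝 α))
    (ht : Tendsto (fun N : ℕ => (t N : ℝ) / N) atTop (𝓝 x)) (htN : ∀ᶠ N in atTop, t N < N)
    (b : ℕ) :
    Tendsto (fun N : ℕ => (N : ℝ) * bestProb g N (T N) b (t N)) atTop
      (𝓝 (α / x * poissonBelow (((K : ℝ) - 1) * Real.log (x / α)) b)) := by
  have hx := hα.trans hαx
  have hTt : ∀ᶠ N in atTop, T N ≤ t N := by
    filter_upwards [hT.eventually_lt ht hαx, eventually_gt_atTop 0] with N h hN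
    have hN' : (0 : ℝ) < N := by exact_mod_cast hN
    exact_mod_cast ((div_lt_div_iff_of_pos_right hN').1 h).le
  have hT' := tendsto_atTop_of_tendsto_div hα hT
  have ht' := tendsto_atTop_of_tendsto_div hx ht
  set F := poissonBelow (((K : ℝ) - 1) * Real.log (x / α)) b
  have hrate := tendsto_sum_recordRate hlam hg hα hx hT ht hTt
  have hcount : ∀ j, Tendsto (fun N => groupCount g j (T N)) atTop atTop := fun j =>
    tendsto_atTop_of_tendsto_div (mul_pos (hlam j) hα) (tendsto_groupCount_div (hg j) hα hT)
  have hsq : ∀ k, Tendsto (fun N => ∑ r ∈ Finset.Ico (T N) (t N), recordRate g k r ^ 2) atTop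
      (𝓝 0) := by
    intro k
    have h0 : Tendsto (fun N => ∑ j, 1 / (groupCount g j (T N) : ℝ)) atTop (𝓝 0) := by
      rw [← Finset.sum_const_zero (s := (Finset.univ : Finset (Fin K)))]
      exact tendsto_finsetSum _ fun j _ =>
        (tendsto_one_div_atTop_nhds_zero_nat (𝕜 := ℝ)).comp (hcount j)
    have h1 := (hrate k).mul h0
    rw [mul_zero] at h1
    refine squeeze_zero' (Eventually.of_forall fun N => Finset.sum_nonneg fun _ _ => sq_nonneg _)
      ?_ h1
    filter_upwards [eventually_all.2 fun j => (hcount j).eventually_gt_atTop 0] with N hN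
    exact sum_recordRate_sq_le g k (t N) hN
  have hdiff : Tendsto (fun N : ℕ => (N : ℝ) * bestProb g N (T N) b (t N) - (T N : ℝ) / t N * F) atTop
      (𝓝 0) := by
    have h1 : Tendsto (fun N =>
        ∑ k, (|poissonBelow (∑ r ∈ Finset.Ico (T N) (t N), recordRate g k r) b - F|
        + ∑ r ∈ Finset.Ico (T N) (t N), recordRate g k r ^ 2)) atTop (𝓝 0) := by
      rw [← Finset.sum_const_zero (s := (Finset.univ : Finset (Fin K)))]
      refine tendsto_finsetSum _ fun k _ => ?_
      have h2 := ((((continuous_poissonBelow b).tendsto _).comp (hrate k)).sub_const F).abs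
      have h3 := h2.add (hsq k)
      simpa [F] using h3
    refine squeeze_zero_norm' ?_ h1
    filter_upwards [hTt, htN, hT'.eventually_ge_atTop 1] with N h1 h2 h3
    exact abs_mul_bestProb_sub_le g h3 h2 h1 b F
  have hquot : Tendsto (fun N => (T N : ℝ) / t N * F) atTop (𝓝 (α / x * F)) := by
    refine (((hT.div ht hx.ne').congr' ?_)).mul_const F
    filter_upwards [eventually_gt_atTop 0] with N hN
    have hN' : (N : ℝ) ≠ 0 := by positivity
    simp only [Pi.div_apply]
    rw [div_div_div_cancel_right₀ hN']
  simpa using hdiff.add hquot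

/-- The integrand is a step function on cells of length `1 / N`; written this way, the sum is open
to dominated convergence. -/
lemma sum_range_eq_integral (f : ℕ → ℝ) {N : ℕ} (hN : 0 < N) :
    ∑ t ∈ Finset.range N, f t = ∫ x in (0 : ℝ)..1, (N : ℝ) * f ⌊x * N⌋₊ := by
  have hN' : (0 : ℝ) < N := by exact_mod_cast hN
  have hle : ∀ k : ℕ, (k : ℝ) / N ≤ ((k + 1 : ℕ) : ℝ) / N := fun k => by gcongr; simp
  have hEq : ∀ k : ℕ, Set.EqOn (fun x : ℝ => (N : ℝ) * f ⌊x * N⌋₊) (fun _ => (N : ℝ) * f k)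
      (Set.Ioo ((k : ℝ) / N) (((k + 1 : ℕ) : ℝ) / N)) := by
    intro k x hx
    have h1 := (div_lt_iff₀ hN').1 hx.1
    have h2 := (lt_div_iff₀ hN').1 hx.2
    have : ⌊x * N⌋₊ = k := by
      rw [Nat.floor_eq_iff ((Nat.cast_nonneg k).trans h1.le)]
      exact ⟨h1.le, by exact_mod_cast h2⟩
    simp only [this]
  have h := intervalIntegral.sum_integral_adjacent_intervals
    (f := fun x : ℝ => (N : ℝ) * f ⌊x * N⌋₊) (μ := volume) (a := fun k : ℕ => (k : ℝ) / N) (n := N)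
    fun k _ => by
      refine IntervalIntegrable.congr_uIoo (intervalIntegrable_const (c := (N : ℝ) * f k)) ?_
      rw [Set.uIoo_of_le (hle k)]
      exact (hEq k).symm
  rw [Nat.cast_zero, zero_div, div_self hN'.ne'] at h
  rw [← h]
  refine Finset.sum_congr rfl fun k _ => ?_
  rw [intervalIntegral.integral_congr_Ioo_of_le (hle k) (hEq k), intervalIntegral.integral_const]
  push_cast
  rw [smul_eq_mul]
  field_simp
  ring

/-- The limit of the success probability for a fixed sequence of groups with positive densities. -/
lemma tendsto_permProb_succeeds {K : ℕ} {lam : Fin K → ℝ} (hlam : ∀ k, 0 < lam k) {g : ℕ → Fin K}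
    (hg : ∀ k, Tendsto (fun m : ℕ => (groupCount g k m : ℝ) / m) atTop (𝓝 (lam k)))
    {T : ℕ → ℕ} {α : ℝ} (hα : 0 < α)
    (hT : Tendsto (fun N : ℕ => (T N : ℝ) / N) atTop (𝓝 α)) (B : ℕ) :
    Tendsto (fun N => permProb (fun σ => Succeeds (T N + 1) B (σ, fun i : Fin N => g i))) atTop
      (𝓝 (∫ x in (0 : ℝ)..1, if α < x then
        α / x * poissonBelow (((K : ℝ) - 1) * Real.log (x / α)) (B + 1) else 0)) := by
  have hT' := tendsto_atTop_of_tendsto_div hα hT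
  have hev : ∀ᶠ N : ℕ in atTop,
      ∫ x in (0 : ℝ)..1, (N : ℝ) * bestProb g N (T N) (B + 1) ⌊x * N⌋₊ =
      permProb (fun σ => Succeeds (T N + 1) B (σ, fun i : Fin N => g i)) := by
    filter_upwards [hT'.eventually_ge_atTop 1, eventually_gt_atTop 0] with N h1 h2
    rw [permProb_succeeds_eq_sum h1, sum_range_eq_integral _ h2]
  refine Tendsto.congr' hev ?_
  refine intervalIntegral.tendsto_integral_filter_of_dominated_convergence (fun _ => 1) ?_ ?_
    intervalIntegrable_const ?_
  · refine Eventually.of_forall fun N => Measurable.aestronglyMeasurable ?_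
    exact ((measurable_of_countable (fun t : ℕ => (N : ℝ) * bestProb g N (T N) (B + 1) t)).comp
      (Nat.measurable_floor.comp (measurable_id.mul_const (N : ℝ))))
  · refine Eventually.of_forall fun N => Eventually.of_forall fun x _ => ?_
    rw [Real.norm_eq_abs, abs_of_nonneg (mul_nonneg (Nat.cast_nonneg _) (bestProb_nonneg _ _ _ _ _))]
    exact mul_bestProb_le_one _ _ _ _ _
  -- At `x = α` the order of `⌊x * N⌋₊` and `T N` is undetermined; at `x = 1` the time `N` is out of
  -- range and `bestProb` takes its default value `0`.
  · have hne : ∀ᵐ x : ℝ, x ≠ α ∧ x ≠ 1 :=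
      (Measure.ae_ne volume α).and (Measure.ae_ne volume 1)
    filter_upwards [hne] with x hx hxI
    rw [Set.uIoc_of_le zero_le_one] at hxI
    have hx1 : x < 1 := lt_of_le_of_ne hxI.2 hx.2
    have ht : Tendsto (fun N : ℕ => (⌊x * N⌋₊ : ℝ) / N) atTop (𝓝 x) :=
      (tendsto_nat_floor_mul_div_atTop hxI.1.le).comp tendsto_natCast_atTop_atTop
    split_ifs with hαx
    · refine tendsto_mul_bestProb hlam hg hα hαx hT ht ?_ _
      filter_upwards [eventually_gt_atTop 0] with N hN
      have hN' : (0 : ℝ) < N := by exact_mod_cast hN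
      rw [Nat.floor_lt (mul_nonneg hxI.1.le hN'.le)]
      nlinarith
    · have hlt : x < α := lt_of_le_of_ne (not_lt.1 hαx) hx.1
      refine tendsto_const_nhds.congr' ?_
      filter_upwards [ht.eventually_lt hT hlt, eventually_gt_atTop 0] with N h hN
      have hN' : (0 : ℝ) < N := by exact_mod_cast hN
      have h1 : ⌊x * N⌋₊ < T N := by exact_mod_cast (div_lt_div_iff_of_pos_right hN').1 h
      rw [bestProb, dif_neg (by omega), mul_zero]

/-! ### The limiting integral -/

lemma hasDerivAt_sum_pow_div_factorial (b : ℕ) (y : ℝ) :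
    HasDerivAt (fun y : ℝ => ∑ l ∈ Finset.range (b + 1), y ^ l / (l ! : ℝ))
      (∑ l ∈ Finset.range b, y ^ l / (l ! : ℝ)) y := by
  induction b with
  | zero => simpa using hasDerivAt_const y (1 : ℝ)
  | succ b ih =>
    have h := ih.add ((hasDerivAt_pow (b + 1) y).div_const (((b + 1)! : ℕ) : ℝ))
    have e : (fun y : ℝ => ∑ l ∈ Finset.range (b + 1 + 1), y ^ l / (l ! : ℝ))
        = (fun y : ℝ => ∑ l ∈ Finset.range (b + 1), y ^ l / (l ! : ℝ))
          + fun y => y ^ (b + 1) / ((b + 1)! : ℝ) := by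
      funext y
      simp [Finset.sum_range_succ _ (b + 1)]
    rw [e]
    refine h.congr_deriv ?_
    rw [Finset.sum_range_succ _ b, Nat.factorial_succ]
    push_cast
    have : (b : ℝ) + 1 ≠ 0 := by positivity
    have : (b ! : ℝ) ≠ 0 := by positivity
    field_simp

lemma integral_limit {K : ℕ} (hK : 2 ≤ K) (B : ℕ) {α : ℝ} (hα0 : 0 < α) (hα1 : α ≤ 1) :
    (∫ x in (0 : ℝ)..1, if α < x then
        α / x * poissonBelow (((K : ℝ) - 1) * Real.log (x / α)) (B + 1) else 0) =
      α ^ K / ((K : ℝ) - 1) * ∑ b ∈ Finset.range (B + 1),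
          (1 / α ^ (K - 1) -
            ∑ l ∈ Finset.range (b + 1), Real.log (1 / α ^ (K - 1)) ^ l / (l ! : ℝ)) := by
  obtain ⟨n, rfl⟩ : ∃ n, K = n + 1 := ⟨K - 1, by omega⟩
  have hn : (0 : ℝ) < n := by exact_mod_cast (by omega : 0 < n)
  simp only [Nat.add_sub_cancel, Nat.cast_add, Nat.cast_one, add_sub_cancel_right]
  set f : ℝ → ℝ := fun x => α / x * poissonBelow (n * Real.log (x / α)) (B + 1) with hf
  -- With `y = n log (x / α)` one has `exp (-y) = (α / x) ^ n`. Differentiating the truncated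
  -- exponentials lowers their degree by one, so the product rule leaves the differences `y ^ b /
  -- b!`, which form the Poisson sum.
  set G : ℝ → ℝ := fun x => -(α ^ (n + 1) / n) * (x ^ n)⁻¹ *
    ∑ b ∈ Finset.range (B + 1), ∑ l ∈ Finset.range (b + 1), (n * Real.log (x / α)) ^ l / (l ! : ℝ)
    with hG
  have hpos : ∀ x ∈ Set.uIcc α 1, 0 < x := by
    intro x hx
    rw [Set.uIcc_of_le hα1] at hx
    exact hα0.trans_le hx.1
  have hcont : ContinuousOn f (Set.uIcc α 1) := by
    intro x hx
    have := hpos x hx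
    refine ContinuousAt.continuousWithinAt ?_
    refine (continuousAt_const.div continuousAt_id this.ne').mul ?_
    refine (continuous_poissonBelow _).continuousAt.comp (continuousAt_const.mul ?_)
    exact ContinuousAt.log (continuousAt_id.div_const α) (by positivity)
  have hderiv : ∀ x ∈ Set.uIcc α 1, HasDerivAt G (f x) x := by
    intro x hx
    have hx0 := hpos x hx
    have hlog : HasDerivAt (fun x => (n : ℝ) * Real.log (x / α)) (n * (1 / x)) x := by
      refine HasDerivAt.const_mul _ ?_
      refine (((hasDerivAt_id x).div_const α).log (by simp only [id]; positivity)).congr_deriv ?_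
      simp only [id]
      field_simp
    have hsum : HasDerivAt (fun x => ∑ b ∈ Finset.range (B + 1), ∑ l ∈ Finset.range (b + 1),
        (n * Real.log (x / α)) ^ l / (l ! : ℝ))
        (∑ b ∈ Finset.range (B + 1), (∑ l ∈ Finset.range b,
          (n * Real.log (x / α)) ^ l / (l ! : ℝ)) * (n * (1 / x))) x := by
      refine HasDerivAt.fun_sum fun b _ => ?_
      exact (hasDerivAt_sum_pow_div_factorial b (n * Real.log (x / α))).comp x hlog
    have hinv := ((hasDerivAt_pow n x).fun_inv (by positivity)).const_mul (-(α ^ (n + 1) / n))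
    refine (hinv.mul hsum).congr_deriv ?_
    have hexp : Real.exp (-(n * Real.log (x / α))) = α ^ n / x ^ n := by
      rw [Real.exp_neg, mul_comm, Real.exp_mul, Real.exp_log (by positivity), Real.rpow_natCast,
        div_pow, inv_div]
    have hpb : poissonBelow (n * Real.log (x / α)) (B + 1) = α ^ n / x ^ n *
        (∑ b ∈ Finset.range (B + 1), ∑ l ∈ Finset.range (b + 1),
            (n * Real.log (x / α)) ^ l / (l ! : ℝ)
          - ∑ b ∈ Finset.range (B + 1), ∑ l ∈ Finset.range b,
            (n * Real.log (x / α)) ^ l / (l ! : ℝ)) := by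
      rw [← Finset.sum_sub_distrib, poissonBelow, Finset.mul_sum]
      refine Finset.sum_congr rfl fun b _ => ?_
      rw [Finset.sum_range_succ, add_sub_cancel_left, poissonMass, hexp]
    simp only [hf]
    rw [hpb, ← Finset.sum_mul]
    set S₁ := ∑ b ∈ Finset.range (B + 1), ∑ l ∈ Finset.range (b + 1),
            (n * Real.log (x / α)) ^ l / (l ! : ℝ)
    set S₀ := ∑ b ∈ Finset.range (B + 1), ∑ l ∈ Finset.range b,
            (n * Real.log (x / α)) ^ l / (l ! : ℝ)
    obtain ⟨m, rfl⟩ : ∃ m, n = m + 1 := ⟨n - 1, by omega⟩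
    rw [Nat.add_sub_cancel]
    field_simp
    ring
  have hInt : IntervalIntegrable f volume α 1 := hcont.intervalIntegrable
  have h0 : Set.EqOn (fun x => if α < x then f x else 0) (fun _ => 0) (Set.Ioo 0 α) :=
    fun x hx => if_neg (not_lt.2 hx.2.le)
  have h1 : Set.EqOn (fun x => if α < x then f x else 0) f (Set.Ioo α 1) :=
    fun x hx => if_pos hx.1
  rw [← intervalIntegral.integral_add_adjacent_intervals (b := α),
    intervalIntegral.integral_congr_Ioo_of_le hα0.le h0,
    intervalIntegral.integral_congr_Ioo_of_le hα1 h1, intervalIntegral.integral_zero, zero_add,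
    intervalIntegral.integral_eq_sub_of_hasDerivAt hderiv hInt]
  · have e1 : (n : ℝ) * Real.log (1 / α) = Real.log (1 / α ^ n) := by
      rw [← one_div_pow, Real.log_pow]
    -- At `x = α` only the term `l = 0` survives; this endpoint yields the terms `1 / α ^ n`.
    have e2 : ∀ b, ∑ l ∈ Finset.range (b + 1), ((n : ℝ) * Real.log (α / α)) ^ l / (l ! : ℝ)
        = 1 := by
      intro b
      rw [div_self hα0.ne', Real.log_one, mul_zero, Finset.sum_range_succ']
      simp
    simp only [hG, e1, e2, one_pow, inv_one, mul_one, Finset.sum_sub_distrib, Finset.sum_const,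
      Finset.card_range, nsmul_eq_mul]
    field_simp
    ring
  · refine IntervalIntegrable.congr_uIoo (intervalIntegrable_const (c := (0 : ℝ))) ?_
    rw [Set.uIoo_of_le hα0.le]
    exact h0.symm
  · refine hInt.congr_uIoo ?_
    rw [Set.uIoo_of_le hα1]
    exact h1.symm
/-! ### Averaging over the groups -/

lemma isProbabilityMeasure_groupLaw {K : ℕ} {lam : Fin K → ℝ} (hlam : ∀ k, 0 < lam k)
    (hsum : ∑ k, lam k = 1) : IsProbabilityMeasure (groupLaw lam) := by
  refine ⟨?_⟩
  simp only [groupLaw, Measure.coe_finsetSum, Finset.sum_apply, Measure.smul_apply, measure_univ,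
    smul_eq_mul, mul_one]
  rw [← ENNReal.ofReal_sum_of_nonneg fun k _ => (hlam k).le, hsum, ENNReal.ofReal_one]

lemma groupLaw_real_singleton {K : ℕ} {lam : Fin K → ℝ} (hlam : ∀ k, 0 < lam k) (k : Fin K) :
    (groupLaw lam).real {k} = lam k := by
  simp only [Measure.real, groupLaw, Measure.coe_finsetSum, Finset.sum_apply, Measure.smul_apply,
    smul_eq_mul, Measure.dirac_apply' _ (MeasurableSet.of_discrete : MeasurableSet {k})]
  simp [Set.indicator_apply, (hlam k).le]

/-- Almost every sequence of groups has the densities `lam`. -/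
lemma ae_tendsto_groupCount_div {K : ℕ} {lam : Fin K → ℝ} (hlam : ∀ k, 0 < lam k)
    [IsProbabilityMeasure (groupLaw lam)] :
    ∀ᵐ g ∂(Measure.infinitePi fun _ : ℕ => groupLaw lam), ∀ k,
      Tendsto (fun m : ℕ => (groupCount g k m : ℝ) / m) atTop (𝓝 (lam k)) := by
  rw [ae_all_iff]
  intro k
  -- The sum of `X (g i)` over `i < m` is `groupCount g k m`.
  set X : Fin K → ℝ := Set.indicator {k} 1 with hX
  have hXm : Measurable X := measurable_of_countable _
  set μ := Measure.infinitePi fun _ : ℕ => groupLaw lam with hμ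
  have hmap : ∀ i, μ.map (fun g : ℕ → Fin K => g i) = groupLaw lam := fun i =>
    Measure.infinitePi_map_eval (fun _ : ℕ => groupLaw lam) i
  have hid : ∀ i, IdentDistrib (fun g : ℕ → Fin K => X (g i)) (fun g => X (g 0)) μ μ := by
    intro i
    have h : IdentDistrib (fun g : ℕ → Fin K => g i) (fun g => g 0) μ μ :=
      ⟨(measurable_pi_apply i).aemeasurable, (measurable_pi_apply 0).aemeasurable,
        (hmap i).trans (hmap 0).symm⟩
    exact h.comp hXm
  have hind : iIndepFun (fun i (g : ℕ → Fin K) => X (g i)) μ :=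
    iIndepFun_infinitePi (P := fun _ : ℕ => groupLaw lam) (X := fun _ => X) fun _ => hXm
  have hInt : Integrable (fun g : ℕ → Fin K => X (g 0)) μ := by
    refine Integrable.of_bound (hXm.comp (measurable_pi_apply 0)).aestronglyMeasurable 1 ?_
    refine Eventually.of_forall fun g => ?_
    simp only [hX, Set.indicator_apply]
    split_ifs <;> simp
  have hE : ∫ g, X (g 0) ∂μ = lam k := by
    have h0 : AEMeasurable (fun g : ℕ → Fin K => g 0) μ := (measurable_pi_apply 0).aemeasurable
    have := integral_map (f := X) h0 hXm.aestronglyMeasurable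
    rw [← this, hmap, hX, integral_indicator_one MeasurableSet.of_discrete,
      groupLaw_real_singleton hlam]
  have h := strong_law_ae_real (fun i (g : ℕ → Fin K) => X (g i)) hInt
    (fun i j hij => hind.indepFun hij) hid
  rw [hE] at h
  filter_upwards [h] with g hg
  refine hg.congr fun m => ?_
  congr 1
  simp only [hX, Set.indicator_apply, Set.mem_singleton_iff, Pi.one_apply, groupCount,
    Finset.sum_boole]

/-- Puts the groups for all `N` on one probability space, where almost sure convergence makes sense.
-/
lemma pi_eq_map_infinitePi {K : ℕ} (N : ℕ) (P : Measure (Fin K)) [IsProbabilityMeasure P] :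
    (Measure.pi fun _ : Fin N => P) =
      (Measure.infinitePi fun _ : ℕ => P).map (fun g (i : Fin N) => g i) := by
  refine Measure.pi_eq fun s hs => ?_
  rw [Measure.map_apply (by fun_prop) (MeasurableSet.univ_pi hs)]
  set t : ℕ → Set (Fin K) := fun i => if h : i < N then s ⟨i, h⟩ else Set.univ with ht
  have e : (fun (g : ℕ → Fin K) (i : Fin N) => g i) ⁻¹' Set.univ.pi s
      = (Finset.range N : Set ℕ).pi t := by
    ext g
    simp only [Set.mem_preimage, Set.mem_pi, Set.mem_univ, true_imp_iff, Finset.coe_range,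
      Set.mem_Iio, ht]
    constructor
    · intro h i hi
      rw [dif_pos hi]
      exact h ⟨i, hi⟩
    · intro h i
      have := h i i.2
      rwa [dif_pos i.2] at this
  rw [e, Measure.infinitePi_pi _ fun i _ => MeasurableSet.of_discrete,
    ← Fin.prod_univ_eq_prod_range]
  refine Finset.prod_congr rfl fun i _ => ?_
  simp [ht]

lemma successProb_eq_integral {K : ℕ} {lam : Fin K → ℝ} [IsProbabilityMeasure (groupLaw lam)]
    (N T B : ℕ) :
    successProb N lam T B = ∫ g, permProb (fun σ => Succeeds T B (σ, fun i : Fin N => g i))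
      ∂(Measure.infinitePi fun _ : ℕ => groupLaw lam) := by
  have hm : AEStronglyMeasurable (fun g : Fin N → Fin K => permProb fun σ => Succeeds T B (σ, g))
      (Measure.pi fun _ : Fin N => groupLaw lam) :=
    (measurable_of_countable _).aestronglyMeasurable
  rw [successProb, law, Measure.real, Measure.prod_apply_symm MeasurableSet.of_discrete,
    ← integral_toReal (measurable_of_countable _).aemeasurable
      (Eventually.of_forall fun g => measure_lt_top _ _)]
  have e : ∀ g : Fin N → Fin K, (uniformOn (Set.univ : Set (Equiv.Perm (Fin N)))
      ((fun x => (x, g)) ⁻¹' {ω : Outcome N K | Succeeds T B ω})).toReal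
      = permProb fun σ => Succeeds T B (σ, g) := fun g => uniformOn_real_eq_permProb _
  simp only [e]
  rw [pi_eq_map_infinitePi] at hm ⊢
  exact integral_map (Measurable.aemeasurable (by fun_prop)) hm

end Secretary

/-! ### The limit of the success probability -/

theorem mainTheorem1 (K : ℕ) (hK : 2 ≤ K) (lam : Fin K → ℝ) (hlam : ∀ k, 0 < lam k)
    (hsum : ∑ k, lam k = 1) (B : ℕ) (α : ℝ) (hα0 : 0 < α) (hα1 : α ≤ 1) :
    Tendsto (fun N : ℕ => Secretary.successProb N lam ⌊α * (N : ℝ)⌋₊ B) atTop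
      (𝓝 (α ^ K / ((K : ℝ) - 1) *
        ∑ b ∈ Finset.range (B + 1),
          (1 / α ^ (K - 1) -
            ∑ l ∈ Finset.range (b + 1), Real.log (1 / α ^ (K - 1)) ^ l / (l ! : ℝ)))) := by
  have := Secretary.isProbabilityMeasure_groupLaw hlam hsum
  rw [← Secretary.integral_limit hK B hα0 hα1]
  have hfloor : Tendsto (fun N : ℕ => (⌊α * N⌋₊ : ℝ) / N) atTop (𝓝 α) :=
    (tendsto_nat_floor_mul_div_atTop hα0.le).comp tendsto_natCast_atTop_atTop
  have hge := (Secretary.tendsto_atTop_of_tendsto_div hα0 hfloor).eventually_ge_atTop 1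
  -- Step `⌊α * N⌋₊` is time `⌊α * N⌋₊ - 1` counted from `0`; the shift does not affect the limit.
  have hT : Tendsto (fun N : ℕ => ((⌊α * N⌋₊ - 1 : ℕ) : ℝ) / N) atTop (𝓝 α) := by
    have h := hfloor.sub (tendsto_one_div_atTop_nhds_zero_nat (𝕜 := ℝ))
    rw [sub_zero] at h
    refine h.congr' ?_
    filter_upwards [hge] with N hN
    rw [Nat.cast_sub hN, Nat.cast_one, sub_div]
  have hev : ∀ᶠ N : ℕ in atTop,
      ∫ g, Secretary.permProb
          (fun σ => Secretary.Succeeds (⌊α * N⌋₊ - 1 + 1) B (σ, fun i : Fin N => g i))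
        ∂(Measure.infinitePi fun _ : ℕ => Secretary.groupLaw lam) =
      Secretary.successProb N lam ⌊α * (N : ℝ)⌋₊ B := by
    filter_upwards [hge] with N hN
    rw [Secretary.successProb_eq_integral, Nat.sub_add_cancel hN]
  refine Tendsto.congr' hev ?_
  have hlim := tendsto_integral_of_dominated_convergence
    (μ := Measure.infinitePi fun _ : ℕ => Secretary.groupLaw lam)
    (F := fun (N : ℕ) g => Secretary.permProb
      (fun σ => Secretary.Succeeds (⌊α * N⌋₊ - 1 + 1) B (σ, fun i : Fin N => g i)))
    (fun _ => (1 : ℝ)) ?_ (integrable_const _) ?_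
    ((Secretary.ae_tendsto_groupCount_div hlam).mono fun g hg =>
      Secretary.tendsto_permProb_succeeds hlam hg hα0 hT B)
  · simpa using hlim
  · intro N
    refine Measurable.aestronglyMeasurable ?_
    exact (measurable_of_countable fun g : Fin N → Fin K => Secretary.permProb
      (fun σ => Secretary.Succeeds (⌊α * N⌋₊ - 1 + 1) B (σ, g))).comp (by fun_prop)
  · refine fun N => Eventually.of_forall fun g => ?_
    rw [Real.norm_eq_abs, abs_of_nonneg (Secretary.permProb_nonneg _)]
    exact Secretary.permProb_le_one _
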